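/- Let an explicit Runge--Kutta scheme with $s$ stages be given by weights $b_i\in\mathbb C$ and coefficients $a_{ij}\in\mathbb C$ ($1\le j<i\le s$). For a linear system $u'=\mathbf L u$, $\mathbf L\in\mathbb C^{n\times n}$, and a time step $\tau>0$, one step of the scheme is $$u^1=u^0+\tau\sum_{i=1}^s b_iK_i,\qquad K_i=\mathbf L\Big(u^0+\tau\sum_{j=1}^{i-1}a_{ij}K_j\Big),\quad i=1,\dots,s.$$ Its stability function $R$ is the polynomial for which $R(z)$ is the value $u^1$ obtained for the scalar equation $u'=zu$ with $u^0=1$, $\tau=1$. Assume that it has real coefficients and write $R(z)=\sum_{j=0}^{s}c_j\frac{z^j}{j!}$ with $c_j\in\mathbb R$, and $c_j=0$ for $j>s$. The scheme has order $p$ (for linear systems) if, for every $n$, every $\mathbf L\in\mathbb C^{n\times n}$ and every solution $u$ of $u'=\mathbf L u$, one step started at $u^0=u(0)$ satisfies $u^1-u(\tau)=O(\tau^{p+1})$ as $\tau\to0^+$. A matrix $\mathbf L\in\mathbb C^{n\times n}$ is Lyapunov stable if all its eigenvalues have nonpositive real part and those with vanishing real part have equal algebraic and geometric multiplicity. The scheme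 is strongly stable if for all $n\in\mathbb N$, all Lyapunov stable $\mathbf L\in\mathbb C^{n\times n}$ and all Hermitian positive definite $\mathbf P\in\mathbb C^{n\times n}$ with $\mathbf L^*\mathbf P+\mathbf P\mathbf L\le0$ there is $\tau_0>0$ such that $\|u^1\|_{\mathbf P}\le\|u^0\|_{\mathbf P}$ for all $\tau\in(0,\tau_0]$ and all $u^0\in\mathbb C^n$, where $\|u\|_{\mathbf P}=\sqrt{\langle u,\mathbf P u\rangle}$. **Theorem.** Let $p\ge1$ and let the scheme be of order $p$. The scheme is not strongly stable in each of the following cases: - $p$ is odd and $(-1)^{(p+1)/2}(1-c_{p+1})<0$; - $p$ is even and at least one of the following two inequalities holds: $$(-1)^{p/2}\big(c_{p+2}-(p+2)c_{p+1}+(p+1)\big)<0,\qquad 1+(-1)^{p/2}(c_{p+1}-1)\binom{p}{p/2}<0.$$ -/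

import Mathlib

open scoped Matrix Topology Nat ComplexOrder

noncomputable section

/-- The coefficients of an explicit Runge–Kutta scheme with `s` stages: weights `b i` and
Runge–Kutta matrix `a i j`, of which only the entries with `j < i` enter the scheme. -/
structure ExplicitRK (s : ℕ) where
  a : Fin s → Fin s → ℂ
  b : Fin s → ℂ

namespace ExplicitRK

variable {s : ℕ} {V : Type*} [AddCommGroup V] [Module ℂ V]

/-- The stages `K i = f (u + τ ∑_{j < i} a i j • K j)` for the autonomous equation `u' = f u`. -/
def stage (rk : ExplicitRK s) (f : V → V) (τ : ℝ) (u : V) (i : Fin s) : V :=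
  f (u + (τ : ℂ) • ∑ j : Fin i.val,
    rk.a i ⟨j.val, j.isLt.trans i.isLt⟩ • stage rk f τ u ⟨j.val, j.isLt.trans i.isLt⟩)
termination_by i.val
decreasing_by exact j.isLt

/-- One step `u⁰ ↦ u¹ = u⁰ + τ ∑ i, b i • K i` of the scheme with time step `τ`. -/
def step (rk : ExplicitRK s) (f : V → V) (τ : ℝ) (u : V) : V :=
  u + (τ : ℂ) • ∑ i : Fin s, rk.b i • rk.stage f τ u i

/-- The stability function: one step of size `1` for the scalar equation `u' = z u`, `u 0 = 1`. -/
def stabilityFunction (rk : ExplicitRK s) (z : ℂ) : ℂ :=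
  rk.step (fun w : ℂ => z * w) 1 1

/-- The real numbers `c j` are the normalized coefficients of the stability function:
`R z = ∑_{j ≤ s} c j * z ^ j / j!`, and `c j = 0` for `j > s`. -/
def HasStabilityCoeffs (rk : ExplicitRK s) (c : ℕ → ℝ) : Prop :=
  (∀ z : ℂ, rk.stabilityFunction z =
    ∑ j ∈ Finset.range (s + 1), (c j : ℂ) * (z ^ j / (j ! : ℂ))) ∧
  ∀ j : ℕ, s < j → c j = 0

/-- The scheme has order (at least) `p` for linear systems `u' = L u`: the error of one step,
started on an exact solution, is `O(τ ^ (p + 1))` as `τ → 0+`. -/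
def HasOrder (rk : ExplicitRK s) (p : ℕ) : Prop :=
  ∀ (n : ℕ) (L : Matrix (Fin n) (Fin n) ℂ) (u : ℝ → Fin n → ℂ),
    (∀ t : ℝ, HasDerivAt u (L *ᵥ u t) t) →
      (fun τ : ℝ => rk.step (fun w => L *ᵥ w) τ (u 0) - u τ)
        =O[𝓝[>] 0] (fun τ : ℝ => τ ^ (p + 1))

end ExplicitRK

/-- All eigenvalues have nonpositive real part, and those with vanishing real part are
non-defective (algebraic and geometric multiplicities coincide). -/
def LyapunovStable {n : ℕ} (L : Matrix (Fin n) (Fin n) ℂ) : Prop :=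
  ∀ μ : ℂ, Module.End.HasEigenvalue (Matrix.toLin' L) μ →
    μ.re ≤ 0 ∧
    (μ.re = 0 → L.charpoly.rootMultiplicity μ =
      Module.finrank ℂ (Module.End.eigenspace (Matrix.toLin' L) μ))

/-- The weighted norm `‖u‖_P = √⟨u, P u⟩`, for positive definite `P`. -/
def weightedNorm {n : ℕ} (P : Matrix (Fin n) (Fin n) ℂ) (u : Fin n → ℂ) : ℝ :=
  Real.sqrt (star u ⬝ᵥ (P *ᵥ u)).re

/-- Strong stability: for every Lyapunov stable `L` and every positive definite `P` with
`Lᴴ P + P L ≤ 0`, one has `‖u¹‖_P ≤ ‖u⁰‖_P` for all initial data and all sufficiently small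
time steps. -/
def ExplicitRK.StronglyStable {s : ℕ} (rk : ExplicitRK s) : Prop :=
  ∀ (n : ℕ) (L P : Matrix (Fin n) (Fin n) ℂ),
    LyapunovStable L → P.PosDef → (-(Lᴴ * P + P * L)).PosSemidef →
      ∃ τ₀ : ℝ, 0 < τ₀ ∧ ∀ τ : ℝ, 0 < τ → τ ≤ τ₀ → ∀ u : Fin n → ℂ,
        weightedNorm P (rk.step (fun w => L *ᵥ w) τ u) ≤ weightedNorm P u

end

/-! One step is `R(τL) u`, and order `p` forces `c j = 1` for `j ≤ p`, so `‖R(τL) u‖²` differs from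
its analogue for the exponential series only from `τ ^ (p + 1)` on. Two test problems with `P = 1`
make the increment positive.

For the scalar `L = i` the exponential conserves energy, so the first nonzero coefficient of
`|R(iτ)|² - 1` comes from the defect alone: it sits at `τ ^ (p + 1)` for odd `p`, and at `τ ^ (p +
2)` for even `p`, since `Re i ^ (p + 1) = 0` there. This settles the odd case and the first even
inequality.

For the second inequality, with `p = 2k`, the Hermitian part of `L` has rank one (`rankOneDamped`),
and the exact flow loses `∫₀^τ |y|²`, with `y` the sum of the coordinates. By observability the
first `k + 1` derivatives of `y` at `0` are free (`rankOneDamped_exists_dual`). As `τ₀` is uniform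
in `u`, the data may depend on `τ`: `y` is made to follow the shifted Legendre polynomial on `[0,
τ]`. Dissipation and defect then both scale like `τ ^ (2k + 1)`; `not_le_of_legendre` compares their
constants, and the squared `L²` norm of the Legendre polynomial produces the binomial coefficient.
-/

/-! ### One step as a polynomial in `τL` -/

open Polynomial in
theorem ExplicitRK.exists_stage_eq_aeval {s : ℕ} (rk : ExplicitRK s) (m : ℕ) (hm : m < s) :
    ∃ Q : ℂ[X], ∀ (V : Type) [AddCommGroup V] [Module ℂ V] (f : Module.End ℂ V) (τ : ℝ) (u : V),
      rk.stage f τ u ⟨m, hm⟩ = f (aeval ((τ : ℂ) • f) Q u) := by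
  induction m using Nat.strong_induction_on with
  | _ m ih =>
    choose Q hQ using ih
    refine ⟨1 + X * ∑ j : Fin m, C (rk.a ⟨m, hm⟩ ⟨j, j.2.trans hm⟩) * Q j j.2 (j.2.trans hm), ?_⟩
    intro V _ _ f τ u
    rw [ExplicitRK.stage]
    congr 1
    simp only [map_add, map_one, map_mul, aeval_X, map_sum, aeval_C, LinearMap.add_apply,
      Module.End.one_apply, Module.End.mul_apply, LinearMap.smul_apply, LinearMap.sum_apply,
      Module.algebraMap_end_apply, Finset.smul_sum, map_sum, map_smul, smul_comm (τ : ℂ)]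
    exact congrArg _ (Finset.sum_congr rfl fun j _ => by rw [hQ j j.2])

-- `Q` is chosen before the space and the operator, so it can be identified on `ℂ` and then used for
-- matrices.
open Polynomial in
theorem ExplicitRK.exists_step_eq_aeval {s : ℕ} (rk : ExplicitRK s) :
    ∃ Q : ℂ[X], ∀ (V : Type) [AddCommGroup V] [Module ℂ V] (f : Module.End ℂ V) (τ : ℝ) (u : V),
      rk.step f τ u = aeval ((τ : ℂ) • f) Q u := by
  choose Q hQ using rk.exists_stage_eq_aeval
  refine ⟨1 + X * ∑ j : Fin s, C (rk.b j) * Q j j.2, ?_⟩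
  intro V _ _ f τ u
  rw [ExplicitRK.step]
  simp only [map_add, map_one, map_mul, aeval_X, map_sum, aeval_C, LinearMap.add_apply,
    Module.End.one_apply, Module.End.mul_apply, LinearMap.smul_apply, LinearMap.sum_apply,
    Module.algebraMap_end_apply, Finset.smul_sum, map_sum, map_smul, hQ, smul_comm (τ : ℂ)]

open Polynomial in
/-- One step for a linear system is the stability polynomial evaluated at `τ L`. -/
theorem ExplicitRK.HasStabilityCoeffs.step_eq {s : ℕ} {rk : ExplicitRK s} {c : ℕ → ℝ}
    (hc : rk.HasStabilityCoeffs c) {N : ℕ} (hN : s < N) {V : Type} [AddCommGroup V] [Module ℂ V]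
    (f : Module.End ℂ V) (τ : ℝ) (u : V) :
    rk.step f τ u = ∑ j ∈ Finset.range N, ((c j / j ! * τ ^ j : ℝ) : ℂ) • (f ^ j) u := by
  obtain ⟨Q, hQ⟩ := rk.exists_step_eq_aeval
  have hQe : Q = ∑ j ∈ Finset.range (s + 1), C ((c j : ℂ) / (j ! : ℂ)) * X ^ j := by
    refine Polynomial.funext fun z => ?_
    have h := hc.1 z
    -- Multiplication by `z` on `ℂ` with `τ = 1` is the stability function, so `Q` is determined by
    -- its values.
    have h2 := hQ ℂ (z • (1 : Module.End ℂ ℂ)) 1 1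
    have h3 : ((z • (1 : Module.End ℂ ℂ) : Module.End ℂ ℂ) : ℂ → ℂ) = fun w => z * w := by
      ext w; simp
    rw [h3] at h2
    rw [ExplicitRK.stabilityFunction, h2] at h
    have h4 : ((1 : ℝ) : ℂ) • (z • (1 : Module.End ℂ ℂ)) = algebraMap ℂ (Module.End ℂ ℂ) z := by
      simp [Algebra.algebraMap_eq_smul_one]
    rw [h4, aeval_algebraMap_apply] at h
    simp only [coe_aeval_eq_eval, Module.algebraMap_end_apply, smul_eq_mul, mul_one] at h
    rw [h, eval_finsetSum]
    refine Finset.sum_congr rfl fun j _ => ?_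
    simp
    ring
  rw [hQ, hQe, map_sum, LinearMap.sum_apply]
  rw [← Finset.sum_subset (Finset.range_subset_range.2 hN : Finset.range (s + 1) ⊆ Finset.range N)]
  · refine Finset.sum_congr rfl fun j _ => ?_
    simp only [map_mul, aeval_C, map_pow, aeval_X, Module.End.mul_apply,
      Module.algebraMap_end_apply, _root_.smul_pow, LinearMap.smul_apply, smul_smul]
    push_cast
    rfl
  · intro j _ hj
    simp only [Finset.mem_range, not_lt] at hj
    simp [hc.2 j hj]

theorem ExplicitRK.HasStabilityCoeffs.step_mulVec {s : ℕ} {rk : ExplicitRK s} {c : ℕ → ℝ}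
    (hc : rk.HasStabilityCoeffs c) {N : ℕ} (hN : s < N) {n : ℕ} (L : Matrix (Fin n) (Fin n) ℂ)
    (τ : ℝ) (u : Fin n → ℂ) :
    rk.step (fun w => L *ᵥ w) τ u =
      ∑ j ∈ Finset.range N, (c j / j ! * τ ^ j) • (L ^ j) *ᵥ u := by
  have := hc.step_eq hN (Matrix.toLin' L) τ u
  rw [show ((Matrix.toLin' L : Module.End ℂ (Fin n → ℂ)) : (Fin n → ℂ) → _) = fun w => L *ᵥ w from
    rfl] at this
  rw [this]
  refine Finset.sum_congr rfl fun j _ => ?_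
  rw [← Matrix.toLin'_pow, Matrix.toLin'_apply, Complex.coe_smul]

/-! ### Order conditions -/

theorem eq_zero_of_sum_pow_isBigO {N : ℕ} (d : ℕ → ℝ) (m : ℕ)
    (h : (fun τ : ℝ => ∑ j ∈ Finset.range N, d j * τ ^ j) =O[𝓝[>] 0] fun τ : ℝ => τ ^ m) :
    ∀ j < N, j < m → d j = 0 := by
  intro j
  induction j using Nat.strong_induction_on with
  | _ j ih =>
    intro hjN hjm
    have h0 : Filter.Tendsto (fun τ : ℝ => (∑ i ∈ Finset.range N, d i * τ ^ i) / τ ^ j)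
        (𝓝[>] 0) (𝓝 0) := by
      have h1 : (fun τ : ℝ => τ ^ m) =o[𝓝[>] 0] fun τ : ℝ => τ ^ j :=
        (Asymptotics.isLittleO_pow_pow hjm).mono nhdsWithin_le_nhds
      exact (h.trans_isLittleO h1).tendsto_div_nhds_zero
    have h2 : Filter.Tendsto (fun τ : ℝ => ∑ i ∈ Finset.range (N - j), d (j + i) * τ ^ i)
        (𝓝[>] 0) (𝓝 (d j)) := by
      have : Continuous (fun τ : ℝ => ∑ i ∈ Finset.range (N - j), d (j + i) * τ ^ i) := by fun_prop
      have h3 := (this.tendsto 0).mono_left (nhdsWithin_le_nhds (s := Set.Ioi 0))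
      convert h3 using 2
      rw [Finset.sum_eq_single 0]
      · simp
      · intro b _ hb; simp [hb]
      · intro hb; simp only [Finset.mem_range, not_lt] at hb; omega
    refine tendsto_nhds_unique (h2.congr' ?_) h0
    filter_upwards [self_mem_nhdsWithin] with τ hτ
    have hτ' : τ ≠ 0 := ne_of_gt hτ
    rw [eq_div_iff (pow_ne_zero _ hτ'), ← Finset.sum_range_add_sum_Ico _ hjN.le,
      Finset.sum_Ico_eq_sum_range, Finset.sum_mul,
      Finset.sum_eq_zero (s := Finset.range j), zero_add]
    · exact Finset.sum_congr rfl fun i _ => by ring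
    · intro i hi
      rw [Finset.mem_range] at hi
      rw [ih i hi (hi.trans hjN) (hi.trans hjm), zero_mul]

/-- The single equation `u' = u` suffices: replacing `exp τ` by its Taylor polynomial of degree `p`
leaves a polynomial that is `O(τ ^ (p + 1))`. -/
theorem ExplicitRK.HasOrder.coeff_eq_one {s : ℕ} {rk : ExplicitRK s} {p : ℕ}
    (hord : rk.HasOrder p) {c : ℕ → ℝ} (hc : rk.HasStabilityCoeffs c) {j : ℕ} (hj : j ≤ p) :
    c j = 1 := by
  have h := hord 1 1 (fun t _ => (Real.exp t : ℂ)) (fun t => by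
    rw [Matrix.one_mulVec, hasDerivAt_pi]
    intro _
    exact (Real.hasDerivAt_exp t).ofReal_comp)
  have hN : s < s + p + 1 := by omega
  have h2 : (fun τ : ℝ => (∑ j ∈ Finset.range (s + p + 1), c j / j ! * τ ^ j) - Real.exp τ)
      =O[𝓝[>] 0] fun τ : ℝ => τ ^ (p + 1) := by
    refine (Asymptotics.isBigO_of_le _ fun τ => ?_).trans h
    rw [hc.step_mulVec hN]
    refine le_trans (le_of_eq ?_) (norm_le_pi_norm _ (0 : Fin 1))
    rw [← Complex.norm_real]
    congr 1
    simp [Finset.sum_apply]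
  have h3 : (fun τ : ℝ => ∑ j ∈ Finset.range (s + p + 1),
      ((c j - if j < p + 1 then 1 else 0) / j !) * τ ^ j) =O[𝓝[>] 0] fun τ : ℝ => τ ^ (p + 1) := by
    refine (h2.add ((Real.exp_sub_sum_range_isBigO_pow (p + 1)).mono nhdsWithin_le_nhds)).congr_left fun τ => ?_
    have h5 : ∑ j ∈ Finset.range (s + p + 1), (if j < p + 1 then τ ^ j / (j ! : ℝ) else 0) =
        ∑ j ∈ Finset.range (p + 1), τ ^ j / j ! := by
      rw [← Finset.sum_filter]
      congr 1
      ext j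
      simp only [Finset.mem_filter, Finset.mem_range]
      omega
    rw [sub_add_sub_cancel, ← h5, ← Finset.sum_sub_distrib]
    refine Finset.sum_congr rfl fun j _ => ?_
    split_ifs <;> ring
  have h4 := eq_zero_of_sum_pow_isBigO _ _ h3 j (by omega) (by omega)
  rw [if_pos (by omega), div_eq_zero_iff] at h4
  rcases h4 with h4 | h4
  · linarith
  · exact absurd h4 (by positivity)

/-! ### Shifted Legendre polynomials and their norm -/

open Polynomial in
/-- The linear functional `f ↦ ∫₀¹ f` on real polynomials. -/
noncomputable def unitIntegral : ℝ[X] →ₗ[ℝ] ℝ :=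
  Polynomial.lsum fun m => ((m : ℝ) + 1)⁻¹ • LinearMap.id

section Legendre
open Polynomial

theorem unitIntegral_eq_sum (f : ℝ[X]) {N : ℕ} (hN : f.natDegree < N) :
    unitIntegral f = ∑ m ∈ Finset.range N, f.coeff m / (m + 1) := by
  rw [unitIntegral, lsum_apply, Polynomial.sum_over_range' _ (by simp) _ hN]
  refine Finset.sum_congr rfl fun m _ => ?_
  simp
  ring

theorem unitIntegral_derivative (f : ℝ[X]) :
    unitIntegral (derivative f) = f.eval 1 - f.eval 0 := by
  induction f using Polynomial.induction_on' with
  | add p q hp hq => simp only [map_add, hp, hq, eval_add]; ring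
  | monomial n a =>
    rw [derivative_monomial, unitIntegral, lsum_apply, Polynomial.sum_monomial_index _ _ (by simp)]
    rcases n with _ | n
    · simp
    · simp
      field_simp

theorem unitIntegral_mul_derivative {f g : ℝ[X]} (h0 : g.eval 0 = 0) (h1 : g.eval 1 = 0) :
    unitIntegral (f * derivative g) = -unitIntegral (derivative f * g) := by
  have h := unitIntegral_derivative (f * g)
  rw [derivative_mul, map_add, eval_mul, eval_mul, h0, h1] at h
  linarith

theorem unitIntegral_beta (a b : ℕ) :
    unitIntegral (X ^ a * (1 - X) ^ b) = (a ! : ℝ) * b ! / (a + b + 1)! := by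
  induction b generalizing a with
  | zero =>
    rw [pow_zero, mul_one, unitIntegral, lsum_apply, X_pow_eq_monomial,
      Polynomial.sum_monomial_index _ _ (by simp)]
    simp [Nat.factorial_succ]
    field_simp
  | succ b ih =>
    -- This product vanishes at both endpoints, so its derivative trades a factor `1 - X` for a
    -- factor `X`.
    have h := unitIntegral_derivative (X ^ (a + 1) * (1 - X) ^ (b + 1))
    have h2 : derivative (X ^ (a + 1) * (1 - X) ^ (b + 1) : ℝ[X]) =
        ((a : ℝ) + 1) • (X ^ a * (1 - X) ^ (b + 1)) - ((b : ℝ) + 1) • (X ^ (a + 1) * (1 - X) ^ b) := by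
      rw [derivative_mul, derivative_X_pow, derivative_pow]
      simp only [smul_eq_C_mul]
      simp
      ring
    rw [h2, map_sub, map_smul, map_smul, ih] at h
    simp only [smul_eq_mul, eval_mul, eval_pow, eval_X, eval_sub, eval_one] at h
    rw [show a + 1 + b + 1 = a + (b + 1) + 1 by ring] at h
    rw [Nat.factorial_succ a] at h
    rw [Nat.factorial_succ b]
    push_cast at h ⊢
    have ha : (a : ℝ) + 1 ≠ 0 := by positivity
    apply mul_left_cancel₀ ha
    simp at h
    rw [sub_eq_zero.1 h]
    ring

/-- The Rodrigues weight `(X (1 - X)) ^ k`, whose `k`-th derivative is a multiple of the shifted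
Legendre polynomial. -/
noncomputable def rodriguesWeight (k : ℕ) : ℝ[X] := X ^ k * (1 - X) ^ k

theorem rodriguesWeight_iterate_derivative_eval_zero {k j : ℕ} (hj : j < k) :
    (derivative^[j] (rodriguesWeight k)).eval 0 = 0 := by
  have h : (X : ℝ[X]) ^ (k - j) ∣ derivative^[j] (rodriguesWeight k) :=
    pow_sub_dvd_iterate_derivative_of_pow_dvd j (Dvd.intro _ rfl)
  obtain ⟨q, hq⟩ := h
  rw [hq]
  simp [Nat.sub_ne_zero_of_lt hj]

theorem rodriguesWeight_iterate_derivative_eval_one {k j : ℕ} (hj : j < k) :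
    (derivative^[j] (rodriguesWeight k)).eval 1 = 0 := by
  have h : (1 - X : ℝ[X]) ^ (k - j) ∣ derivative^[j] (rodriguesWeight k) :=
    pow_sub_dvd_iterate_derivative_of_pow_dvd j (Dvd.intro_left _ rfl)
  obtain ⟨q, hq⟩ := h
  rw [hq]
  simp [Nat.sub_ne_zero_of_lt hj]

theorem unitIntegral_mul_iterate_derivative_rodriguesWeight (f : ℝ[X]) (k j : ℕ) (hj : j ≤ k) :
    unitIntegral (f * derivative^[j] (rodriguesWeight k)) =
      (-1) ^ j * unitIntegral (derivative^[j] f * rodriguesWeight k) := by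
  induction j generalizing f with
  | zero => simp
  | succ j ih =>
    rw [Function.iterate_succ_apply' _ j (rodriguesWeight k), unitIntegral_mul_derivative
      (rodriguesWeight_iterate_derivative_eval_zero hj)
      (rodriguesWeight_iterate_derivative_eval_one hj), ih _ (by omega),
      ← Function.iterate_succ_apply]
    ring

theorem rodriguesWeight_natDegree_le (k : ℕ) : (rodriguesWeight k).natDegree ≤ 2 * k := by
  have h : (1 - X : ℝ[X]).natDegree ≤ 1 := by
    refine (natDegree_sub_le _ _).trans ?_
    simp
  refine natDegree_mul_le.trans ?_
  have := natDegree_pow_le_of_le k h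
  rw [natDegree_X_pow]
  omega

theorem rodriguesWeight_coeff_two_mul (k : ℕ) : (rodriguesWeight k).coeff (2 * k) = (-1) ^ k := by
  have h : (1 - X : ℝ[X]).natDegree ≤ 1 := by
    refine (natDegree_sub_le _ _).trans ?_
    simp
  have h2 := coeff_pow_of_natDegree_le (m := k) h
  rw [rodriguesWeight, two_mul, coeff_X_pow_mul]
  rw [mul_one] at h2
  rw [h2]
  simp [coeff_one]

theorem rodriguesWeight_iterate_derivative_two_mul (k : ℕ) :
    derivative^[2 * k] (rodriguesWeight k) = C ((2 * k)! * (-1) ^ k : ℝ) := by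
  ext m
  rw [coeff_iterate_derivative, coeff_C]
  split_ifs with h
  · subst h
    rw [zero_add, rodriguesWeight_coeff_two_mul, Nat.descFactorial_self, nsmul_eq_mul]
  · rw [coeff_eq_zero_of_natDegree_lt, smul_zero]
    have := rodriguesWeight_natDegree_le k
    omega

/-- Derivatives at `0` of the unnormalized shifted Legendre polynomial. -/
noncomputable def legendreCoeff (k i : ℕ) : ℝ := (derivative^[k + i] (rodriguesWeight k)).eval 0

theorem legendreCoeff_self (k : ℕ) : legendreCoeff k k = (2 * k)! * (-1) ^ k := by
  rw [legendreCoeff, ← two_mul, rodriguesWeight_iterate_derivative_two_mul, eval_C]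

theorem legendreCoeff_eq_zero {k i : ℕ} (h : k < i) : legendreCoeff k i = 0 := by
  rw [legendreCoeff, iterate_derivative_eq_zero, eval_zero]
  have := rodriguesWeight_natDegree_le k
  omega

/-- The squared `L²` norm of the unnormalized shifted Legendre polynomial. -/
theorem sum_legendreCoeff_mul (k : ℕ) :
    ∑ m ∈ Finset.range (2 * k + 1), (∑ ij ∈ Finset.HasAntidiagonal.antidiagonal m,
      legendreCoeff k ij.1 / ij.1 ! * (legendreCoeff k ij.2 / ij.2 !)) / ((m : ℝ) + 1) =
      (k ! : ℝ) ^ 2 / (2 * k + 1) := by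
  obtain ⟨q, hq⟩ : ∃ q, q = derivative^[k] (rodriguesWeight k) := ⟨_, rfl⟩
  have hcoeff : ∀ i, q.coeff i = legendreCoeff k i / i ! := by
    intro i
    rw [legendreCoeff, add_comm, Function.iterate_add_apply, ← hq, ← coeff_zero_eq_eval_zero,
      coeff_iterate_derivative, zero_add, Nat.descFactorial_self, nsmul_eq_mul]
    field_simp
  have hdeg : q.natDegree ≤ k := by
    rw [hq]
    have := natDegree_iterate_derivative (rodriguesWeight k) k
    have := rodriguesWeight_natDegree_le k
    omega
  have hdeg2 : (q * q).natDegree < 2 * k + 1 := by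
    have := natDegree_mul_le (p := q) (q := q)
    omega
  have h := unitIntegral_eq_sum (q * q) hdeg2
  simp only [coeff_mul, hcoeff] at h
  rw [← h]
  -- Moving `k` derivatives onto the other factor makes it constant and leaves a beta integral.
  rw [show q * q = q * derivative^[k] (rodriguesWeight k) by rw [← hq], unitIntegral_mul_iterate_derivative_rodriguesWeight _ _ _ le_rfl, hq,
    ← Function.iterate_add_apply, ← two_mul, rodriguesWeight_iterate_derivative_two_mul,
    ← smul_eq_C_mul, map_smul, rodriguesWeight, unitIntegral_beta, ← two_mul,
    Nat.factorial_succ (2 * k), smul_eq_mul]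
  have h1 : ((-1 : ℝ) ^ k) * (-1) ^ k = 1 := by rw [← mul_pow]; simp
  have h2 : ((2 * k)! : ℝ) ≠ 0 := by positivity
  push_cast
  field_simp
  linear_combination h1

end Legendre

/-! ### Energy expansion in powers of `τ` -/

section Energy
open Finset.HasAntidiagonal (antidiagonal)

/-- The coefficient of `τ ^ m` in `∑ i j, (r i τ ^ i) (r j τ ^ j) b i j`. -/
noncomputable def energyCoeff (r : ℕ → ℝ) (b : ℕ → ℕ → ℝ) (m : ℕ) : ℝ :=
  ∑ ij ∈ antidiagonal m, r ij.1 * r ij.2 * b ij.1 ij.2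

theorem sum_sum_eq_sum_energyCoeff {r : ℕ → ℝ} {N : ℕ} (hr : ∀ j, N ≤ j → r j = 0)
    (b : ℕ → ℕ → ℝ) (τ : ℝ) :
    ∑ i ∈ Finset.range N, ∑ j ∈ Finset.range N, (r i * τ ^ i) * ((r j * τ ^ j) * b i j) =
      ∑ m ∈ Finset.range (2 * N), τ ^ m * energyCoeff r b m := by
  rw [← Finset.sum_product', ← Finset.sum_fiberwise_of_maps_to (g := fun ij : ℕ × ℕ => ij.1 + ij.2)
    (t := Finset.range (2 * N))]
  · refine Finset.sum_congr rfl fun m _ => ?_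
    rw [energyCoeff, Finset.mul_sum]
    refine (Finset.sum_subset_zero_on_sdiff ?_ ?_ ?_)
    · intro ij hij
      simp only [Finset.mem_filter] at hij
      exact Finset.HasAntidiagonal.mem_antidiagonal.2 hij.2
    · intro ij hij
      simp only [Finset.mem_sdiff, Finset.HasAntidiagonal.mem_antidiagonal, Finset.mem_filter,
        Finset.mem_product, Finset.mem_range] at hij
      have : N ≤ ij.1 ∨ N ≤ ij.2 := by
        by_contra! h
        exact hij.2 ⟨h, hij.1⟩
      rcases this with h | h <;> simp [hr _ h]
    · intro ij hij
      simp only [Finset.mem_filter] at hij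
      rw [← hij.2]
      ring
  · intro ij hij
    simp only [Finset.mem_product, Finset.mem_range] at hij ⊢
    omega

/-- The energy balance of the exponential, coefficient by coefficient. -/
theorem energyCoeff_exp_succ {b g : ℕ → ℕ → ℝ} (hb : ∀ i j, b (i + 1) j + b i (j + 1) = -g i j)
    (m : ℕ) :
    energyCoeff (fun j => 1 / (j ! : ℝ)) b (m + 1) =
      -(energyCoeff (fun j => 1 / (j ! : ℝ)) g m / ((m : ℝ) + 1)) := by
  have hm : (m : ℝ) + 1 ≠ 0 := by positivity
  rw [← neg_div, eq_div_iff hm, energyCoeff, energyCoeff, ← Finset.sum_neg_distrib]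
  -- Splitting `m + 1 = i + j` lets each index cancel against its factorial, which shifts `i` or `j`
  -- down by one.
  have h1 : ∀ f : ℕ → ℕ → ℝ, (∑ ij ∈ antidiagonal (m + 1), f ij.1 ij.2) * ((m : ℝ) + 1) =
      ∑ ij ∈ antidiagonal (m + 1), (ij.1 : ℝ) * f ij.1 ij.2 +
        ∑ ij ∈ antidiagonal (m + 1), (ij.2 : ℝ) * f ij.1 ij.2 := by
    intro f
    rw [← Finset.sum_add_distrib, Finset.sum_mul]
    refine Finset.sum_congr rfl fun ij hij => ?_
    have h : ((ij.1 + ij.2 : ℕ) : ℝ) = ((m + 1 : ℕ) : ℝ) := by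
      rw [Finset.HasAntidiagonal.mem_antidiagonal.1 hij]
    push_cast at h
    rw [← h]
    ring
  rw [h1 (fun i j => 1 / (i ! : ℝ) * (1 / (j ! : ℝ)) * b i j), Finset.Nat.sum_antidiagonal_succ,
    Finset.Nat.sum_antidiagonal_succ']
  simp only [Nat.cast_zero, zero_mul, zero_add]
  rw [← Finset.sum_add_distrib]
  refine Finset.sum_congr rfl fun ij _ => ?_
  have h := hb ij.1 ij.2
  simp only [Nat.factorial_succ]
  push_cast
  have h2 : ((ij.1 : ℝ) + 1) ≠ 0 := by positivity
  have h3 : ((ij.2 : ℝ) + 1) ≠ 0 := by positivity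
  field_simp
  linarith

theorem energyCoeff_congr {r r' : ℕ → ℝ} {p : ℕ} (hr : ∀ j ≤ p, r j = r' j) (b : ℕ → ℕ → ℝ) {m : ℕ}
    (hm : m ≤ p) : energyCoeff r b m = energyCoeff r' b m := by
  refine Finset.sum_congr rfl fun ij hij => ?_
  have h := Finset.HasAntidiagonal.mem_antidiagonal.1 hij
  rw [hr _ (by omega), hr _ (by omega)]

theorem sum_antidiagonal_add_two (f : ℕ → ℕ → ℝ) (q : ℕ) :
    ∑ ij ∈ antidiagonal (q + 2), f ij.1 ij.2 =
      f 0 (q + 2) + f (q + 2) 0 + ∑ ij ∈ antidiagonal q, f (ij.1 + 1) (ij.2 + 1) := by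
  rw [Finset.Nat.sum_antidiagonal_succ, Finset.Nat.sum_antidiagonal_succ']
  exact (add_assoc _ _ _).symm

/-- Only the two ends of the antidiagonal involve an index above `p`. -/
theorem energyCoeff_first_defect {r r' : ℕ → ℝ} {p : ℕ} (hp : 1 ≤ p) (hr : ∀ j ≤ p, r j = r' j)
    (h0 : r' 0 = 1) {b : ℕ → ℕ → ℝ} (hsymm : ∀ i j, b i j = b j i) :
    energyCoeff r b (p + 1) =
      energyCoeff r' b (p + 1) + 2 * (r (p + 1) - r' (p + 1)) * b 0 (p + 1) := by
  obtain ⟨q, rfl⟩ : ∃ q, p = q + 1 := ⟨p - 1, by omega⟩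
  have h : ∑ ij ∈ antidiagonal q, r (ij.1 + 1) * r (ij.2 + 1) * b (ij.1 + 1) (ij.2 + 1) =
      ∑ ij ∈ antidiagonal q, r' (ij.1 + 1) * r' (ij.2 + 1) * b (ij.1 + 1) (ij.2 + 1) := by
    refine Finset.sum_congr rfl fun ij hij => ?_
    have h := Finset.HasAntidiagonal.mem_antidiagonal.1 hij
    rw [hr _ (by omega), hr (ij.2 + 1) (by omega)]
  rw [energyCoeff, energyCoeff, sum_antidiagonal_add_two (fun i j => r i * r j * b i j),
    sum_antidiagonal_add_two (fun i j => r' i * r' j * b i j), h, hsymm (q + 2) 0, hr 0 (by omega),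
    h0]
  ring

theorem energyCoeff_second_defect {r r' : ℕ → ℝ} {p : ℕ} (hp : 2 ≤ p) (hr : ∀ j ≤ p, r j = r' j)
    (h0 : r' 0 = 1) (h1 : r' 1 = 1) {b : ℕ → ℕ → ℝ} (hsymm : ∀ i j, b i j = b j i) :
    energyCoeff r b (p + 2) =
      energyCoeff r' b (p + 2) + 2 * (r (p + 2) - r' (p + 2)) * b 0 (p + 2) +
        2 * (r (p + 1) - r' (p + 1)) * b 1 (p + 1) := by
  obtain ⟨q, rfl⟩ : ∃ q, p = q + 2 := ⟨p - 2, by omega⟩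
  have h : ∑ ij ∈ antidiagonal q,
        r (ij.1 + 1 + 1) * r (ij.2 + 1 + 1) * b (ij.1 + 1 + 1) (ij.2 + 1 + 1) =
      ∑ ij ∈ antidiagonal q,
        r' (ij.1 + 1 + 1) * r' (ij.2 + 1 + 1) * b (ij.1 + 1 + 1) (ij.2 + 1 + 1) := by
    refine Finset.sum_congr rfl fun ij hij => ?_
    have h := Finset.HasAntidiagonal.mem_antidiagonal.1 hij
    rw [hr _ (by omega), hr (ij.2 + 1 + 1) (by omega)]
  rw [energyCoeff, energyCoeff, sum_antidiagonal_add_two (fun i j => r i * r j * b i j),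
    sum_antidiagonal_add_two (fun i j => r' i * r' j * b i j),
    sum_antidiagonal_add_two (fun i j => r (i + 1) * r (j + 1) * b (i + 1) (j + 1)),
    sum_antidiagonal_add_two (fun i j => r' (i + 1) * r' (j + 1) * b (i + 1) (j + 1)),
    h, hsymm (q + 2 + 2) 0, hsymm (q + 2 + 1) (0 + 1), hr 0 (by omega), hr (0 + 1) (by omega), h0,
    show (0 + 1) = 1 from rfl, h1]
  ring

/-- The coefficients may vary with `τ`, as they do when the initial data depend on the time step. -/
theorem not_le_of_tendsto_pos {M K : ℕ} {h : ℕ → ℝ → ℝ} {l : ℕ → ℝ}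
    (hl : ∀ m < M, Filter.Tendsto (fun τ => τ ^ (m + 1) * h (m + 1) τ / τ ^ K) (𝓝[>] 0) (𝓝 (l m)))
    (hpos : 0 < ∑ m ∈ Finset.range M, l m) {τ₀ : ℝ} (hτ₀ : 0 < τ₀)
    (hle : ∀ τ, 0 < τ → τ ≤ τ₀ → ∑ m ∈ Finset.range (M + 1), τ ^ m * h m τ ≤ h 0 τ) : False := by
  have h1 := tendsto_finsetSum (Finset.range M) fun m hm => hl m (Finset.mem_range.1 hm)
  refine absurd (le_of_tendsto h1 ?_) (not_le.2 hpos)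
  filter_upwards [Ioc_mem_nhdsGT hτ₀] with τ hτ
  have h2 := hle τ hτ.1 hτ.2
  rw [Finset.sum_range_succ', pow_zero, one_mul] at h2
  rw [← Finset.sum_div]
  exact div_nonpos_of_nonpos_of_nonneg (by linarith) (pow_nonneg hτ.1.le _)

theorem not_le_of_first_coeff_pos {M m₀ : ℕ} {h : ℕ → ℝ} (hm : m₀ < M)
    (hz : ∀ m < m₀, h (m + 1) = 0) (hpos : 0 < h (m₀ + 1)) {τ₀ : ℝ} (hτ₀ : 0 < τ₀)
    (hle : ∀ τ, 0 < τ → τ ≤ τ₀ → ∑ m ∈ Finset.range (M + 1), τ ^ m * h m ≤ h 0) : False := by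
  refine not_le_of_tendsto_pos (K := m₀ + 1) (h := fun m _ => h m)
    (l := fun m => if m = m₀ then h (m₀ + 1) else 0) ?_ ?_ hτ₀ hle
  · intro m _
    rcases lt_trichotomy m m₀ with hlt | rfl | hgt
    · simp [hz m hlt, hlt.ne]
    · rw [if_pos rfl]
      refine tendsto_const_nhds.congr' ?_
      filter_upwards [self_mem_nhdsWithin] with τ hτ
      have : τ ≠ 0 := ne_of_gt hτ
      field_simp
    · rw [if_neg hgt.ne']
      have hc : Continuous fun τ : ℝ => τ ^ (m - m₀) * h (m + 1) := by fun_prop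
      have ht := (hc.tendsto 0).mono_left (nhdsWithin_le_nhds (s := Set.Ioi 0))
      rw [zero_pow (by omega), zero_mul] at ht
      refine ht.congr' ?_
      filter_upwards [self_mem_nhdsWithin] with τ hτ
      have : τ ≠ 0 := ne_of_gt hτ
      rw [eq_div_iff (pow_ne_zero _ this), show m + 1 = (m - m₀) + (m₀ + 1) by omega,
        pow_add _ (m - m₀)]
      ring
  · simpa [hm] using hpos

/-- While `g` vanishes, an index can be moved from one slot to the other at the cost of a sign. This
leads from `(0, 2k + 1)` to `(k, k + 1)`, where symmetry determines `b`. -/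
theorem bilinear_zero_eq_of_vanishing {b g : ℕ → ℕ → ℝ}
    (hb : ∀ i j, b (i + 1) j + b i (j + 1) = -g i j) (hsymm : ∀ i j, b i j = b j i) {k : ℕ}
    (hg : ∀ i < k, ∀ j, g i j = 0) : b 0 (2 * k + 1) = -((-1) ^ k * g k k / 2) := by
  have h : ∀ i ≤ k, b 0 (2 * k + 1) = (-1) ^ i * b i (2 * k + 1 - i) := by
    intro i
    induction i with
    | zero => simp
    | succ i ih =>
      intro hi
      rw [ih (by omega), pow_succ]
      have h1 := hb i (2 * k + 1 - (i + 1))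
      rw [hg i (by omega), show 2 * k + 1 - (i + 1) + 1 = 2 * k + 1 - i by omega] at h1
      rw [show b i (2 * k + 1 - i) = -b (i + 1) (2 * k + 1 - (i + 1)) by linarith]
      ring
  have h1 := hb k k
  rw [hsymm (k + 1) k] at h1
  rw [h k le_rfl, show 2 * k + 1 - k = k + 1 by omega, show b k (k + 1) = -g k k / 2 by linarith]
  ring

/-- With observations `y i` scaled like the derivatives of the shifted Legendre polynomial on
`[0, τ]`, the dissipation has exact order `τ ^ (2 k + 1)`, and the leading coefficient of the
energy increment is the one displayed in `hpos`. -/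
theorem not_le_of_legendre {k N : ℕ} (hk : 1 ≤ k) (hN : k < N) {r : ℕ → ℝ}
    (hr : ∀ j ≤ 2 * k, r j = 1 / (j ! : ℝ))
    {b : ℝ → ℕ → ℕ → ℝ} {y : ℝ → ℕ → ℂ} (hbc : ∀ i j, Continuous fun τ => b τ i j)
    (hyc : ∀ i, Continuous fun τ => y τ i)
    (hb : ∀ τ i j, b τ (i + 1) j + b τ i (j + 1) = -(star (y τ i) * y τ j).re)
    (hsymm : ∀ τ i j, b τ i j = b τ j i)
    (hy : ∀ τ, ∀ i ≤ k, y τ i = ((τ ^ (k - i) * legendreCoeff k i : ℝ) : ℂ))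
    (hpos : 0 < -((k ! : ℝ) ^ 2 / (2 * k + 1)) -
      (r (2 * k + 1) - 1 / ((2 * k + 1)! : ℝ)) * ((-1) ^ k * ((2 * k)! : ℝ) ^ 2))
    {τ₀ : ℝ} (hτ₀ : 0 < τ₀)
    (hle : ∀ τ, 0 < τ → τ ≤ τ₀ →
      ∑ m ∈ Finset.range (2 * N), τ ^ m * energyCoeff r (b τ) m ≤ energyCoeff r (b τ) 0) :
    False := by
  set a := legendreCoeff k with ha
  set e : ℕ → ℝ := fun j => 1 / (j ! : ℝ) with he
  set δ := r (2 * k + 1) - 1 / ((2 * k + 1)! : ℝ) with hδ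
  -- For `i ≤ k` this is an equality; for `i > k` continuity of `y` gives the limit `0`, as does the
  -- degree of the Legendre polynomial.
  have hz : ∀ i, Filter.Tendsto (fun τ : ℝ => ((τ ^ i / τ ^ k : ℝ) : ℂ) * y τ i) (𝓝[>] 0)
      (𝓝 (a i : ℂ)) := by
    intro i
    rcases le_or_gt i k with hi | hi
    · refine tendsto_const_nhds.congr' ?_
      filter_upwards [self_mem_nhdsWithin] with τ hτ
      have : τ ≠ 0 := ne_of_gt hτ
      rw [hy τ i hi, ← Complex.ofReal_mul]
      congr 1
      have h2 : τ ^ k = τ ^ i * τ ^ (k - i) := by rw [← pow_add]; congr 1; omega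
      rw [h2]
      field_simp
    · rw [ha, legendreCoeff_eq_zero hi]
      have hc : Continuous fun τ : ℝ => ((τ ^ (i - k) : ℝ) : ℂ) * y τ i := by
        have := hyc i
        fun_prop
      have ht := (hc.tendsto 0).mono_left (nhdsWithin_le_nhds (s := Set.Ioi 0))
      rw [zero_pow (by omega), Complex.ofReal_zero, zero_mul] at ht
      rw [Complex.ofReal_zero]
      refine ht.congr' ?_
      filter_upwards [self_mem_nhdsWithin] with τ hτ
      have : τ ≠ 0 := ne_of_gt hτ
      rw [pow_sub₀ _ this hi.le, div_eq_mul_inv]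
  have hg : ∀ i j, Filter.Tendsto (fun τ : ℝ => τ ^ (i + j) * (star (y τ i) * y τ j).re / τ ^ (2 * k))
      (𝓝[>] 0) (𝓝 (a i * a j)) := by
    intro i j
    have h1 := (Complex.continuous_re.tendsto _).comp (((hz i).star).mul (hz j))
    have h2 : (star (a i : ℂ) * (a j : ℂ)).re = a i * a j := by simp
    rw [h2] at h1
    refine h1.congr fun τ => ?_
    simp only [Function.comp]
    rw [star_mul', Complex.star_def, Complex.conj_ofReal,
      show ∀ p q s t : ℂ, p * q * (s * t) = (p * s) * (q * t) by intros; ring,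
      ← Complex.ofReal_mul, Complex.re_ofReal_mul, pow_add, two_mul, pow_add]
    ring
  have hge : ∀ m, Filter.Tendsto (fun τ : ℝ => τ ^ m *
      energyCoeff e (fun i j => (star (y τ i) * y τ j).re) m / τ ^ (2 * k))
      (𝓝[>] 0) (𝓝 (∑ ij ∈ antidiagonal m, a ij.1 / ij.1 ! * (a ij.2 / ij.2 !))) := by
    intro m
    have h1 := tendsto_finsetSum (antidiagonal m) fun ij _ =>
      (hg ij.1 ij.2).const_mul (e ij.1 * e ij.2)
    have h2 : ∑ ij ∈ antidiagonal m, e ij.1 * e ij.2 * (a ij.1 * a ij.2) =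
        ∑ ij ∈ antidiagonal m, a ij.1 / ij.1 ! * (a ij.2 / ij.2 !) :=
      Finset.sum_congr rfl fun ij _ => by simp only [he]; ring
    rw [h2] at h1
    refine h1.congr fun τ => ?_
    rw [energyCoeff, Finset.mul_sum, Finset.sum_div]
    refine Finset.sum_congr rfl fun ij hij => ?_
    rw [← Finset.HasAntidiagonal.mem_antidiagonal.1 hij]
    ring
  have hexp : ∀ m, Filter.Tendsto (fun τ : ℝ => τ ^ (m + 1) * energyCoeff e (b τ) (m + 1) /
      τ ^ (2 * k + 1)) (𝓝[>] 0)
      (𝓝 (-((∑ ij ∈ antidiagonal m, a ij.1 / ij.1 ! * (a ij.2 / ij.2 !)) / ((m : ℝ) + 1)))) := by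
    intro m
    refine ((hge m).div_const _).neg.congr' ?_
    filter_upwards [self_mem_nhdsWithin] with τ hτ
    have : τ ≠ 0 := ne_of_gt hτ
    rw [energyCoeff_exp_succ (hb τ)]
    have : (m : ℝ) + 1 ≠ 0 := by positivity
    field_simp
    ring
  have hb0 : Filter.Tendsto (fun τ => b τ 0 (2 * k + 1)) (𝓝[>] 0)
      (𝓝 (-((-1) ^ k * ((2 * k)! : ℝ) ^ 2 / 2))) := by
    have h1 := ((hbc 0 (2 * k + 1)).tendsto 0).mono_left (nhdsWithin_le_nhds (s := Set.Ioi 0))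
    -- At `τ = 0` the observations of index below `k` vanish.
    rw [bilinear_zero_eq_of_vanishing (hb 0) (hsymm 0) (k := k)] at h1
    · convert h1 using 5
      have h2 : ((-1 : ℝ) ^ k) ^ 2 = 1 := by rw [← pow_mul, mul_comm, pow_mul]; simp
      rw [hy 0 k le_rfl, ha, legendreCoeff_self, Complex.star_def, Complex.conj_ofReal,
        ← Complex.ofReal_mul, Complex.ofReal_re, Nat.sub_self, pow_zero]
      linear_combination -((2 * k)! : ℝ) ^ 2 * h2
    · intro i hi j
      rw [hy 0 i hi.le, zero_pow (by omega)]
      simp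
  have hbound : ∀ m, 2 * k < m → Filter.Tendsto (fun τ : ℝ => τ ^ (m + 1) *
      energyCoeff r (b τ) (m + 1) / τ ^ (2 * k + 1)) (𝓝[>] 0) (𝓝 0) := by
    intro m hm
    have hc : Continuous fun τ : ℝ => τ ^ (m - 2 * k) * energyCoeff r (b τ) (m + 1) := by
      unfold energyCoeff
      fun_prop
    have ht := (hc.tendsto 0).mono_left (nhdsWithin_le_nhds (s := Set.Ioi 0))
    rw [zero_pow (by omega), zero_mul] at ht
    refine ht.congr' ?_
    filter_upwards [self_mem_nhdsWithin] with τ hτ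
    have : τ ≠ 0 := ne_of_gt hτ
    rw [eq_div_iff (pow_ne_zero _ this), show m + 1 = (m - 2 * k) + (2 * k + 1) by omega,
      pow_add _ (m - 2 * k)]
    ring
  obtain ⟨M, hM⟩ : ∃ M, 2 * N = M + 1 := ⟨2 * N - 1, by omega⟩
  rw [hM] at hle
  -- Every `m ≤ 2k` contributes dissipation at the same order `τ ^ (2k + 1)`; the defect enters only
  -- at `m = 2k`.
  refine not_le_of_tendsto_pos (K := 2 * k + 1) (h := fun m τ => energyCoeff r (b τ) m)
    (l := fun m => if m < 2 * k + 1 then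
      -((∑ ij ∈ antidiagonal m, a ij.1 / ij.1 ! * (a ij.2 / ij.2 !)) / ((m : ℝ) + 1)) +
        (if m = 2 * k then 2 * δ * (-((-1) ^ k * ((2 * k)! : ℝ) ^ 2 / 2)) else 0) else 0)
    ?_ ?_ hτ₀ hle
  · intro m _
    rcases lt_trichotomy m (2 * k) with hlt | rfl | hgt
    · rw [if_pos (by omega), if_neg (by omega), add_zero]
      simpa only [energyCoeff_congr hr _ (show m + 1 ≤ 2 * k by omega)] using hexp m
    · rw [if_pos (by omega), if_pos rfl]
      refine ((hexp (2 * k)).add (hb0.const_mul (2 * δ))).congr' ?_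
      filter_upwards [self_mem_nhdsWithin] with τ hτ
      have : τ ≠ 0 := ne_of_gt hτ
      rw [energyCoeff_first_defect (by omega) hr (by simp) (hsymm τ)]
      simp only [hδ, he]
      field_simp
    · rw [if_neg (by omega)]
      exact hbound m hgt
  · have hsub : Finset.range (2 * k + 1) ⊆ Finset.range M :=
      Finset.range_subset_range.2 (by omega)
    rw [← Finset.sum_subset hsub]
    · have h1 := sum_legendreCoeff_mul k
      rw [Finset.sum_congr rfl fun m hm => if_pos (Finset.mem_range.1 hm), Finset.sum_add_distrib,
        Finset.sum_neg_distrib, h1, Finset.sum_ite_eq' , if_pos (by simp)]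
      linarith
    · intro m _ hm
      rw [if_neg (by simpa using hm)]

end Energy

/-! ### Energy of the numerical solution -/

/-- The real inner products `Re ⟨L ^ i u, L ^ j u⟩` of the Krylov vectors. -/
noncomputable def krylovForm {n : ℕ} (L : Matrix (Fin n) (Fin n) ℂ) (u : Fin n → ℂ) (i j : ℕ) : ℝ :=
  (star (L ^ i *ᵥ u) ⬝ᵥ (L ^ j *ᵥ u)).re

theorem krylovForm_comm {n : ℕ} (L : Matrix (Fin n) (Fin n) ℂ) (u : Fin n → ℂ) (i j : ℕ) :
    krylovForm L u i j = krylovForm L u j i := by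
  rw [krylovForm, krylovForm, ← Complex.conj_re, ← Complex.star_def, ← Matrix.star_dotProduct_star,
    star_star]

theorem krylovForm_succ {n : ℕ} (L : Matrix (Fin n) (Fin n) ℂ) (u : Fin n → ℂ) (i j : ℕ) :
    krylovForm L u (i + 1) j + krylovForm L u i (j + 1) =
      (star (L ^ i *ᵥ u) ⬝ᵥ ((Lᴴ + L) *ᵥ (L ^ j *ᵥ u))).re := by
  rw [krylovForm, krylovForm, pow_succ' L i, pow_succ' L j, ← Matrix.mulVec_mulVec,
    ← Matrix.mulVec_mulVec, Matrix.star_mulVec, ← Matrix.dotProduct_mulVec, Matrix.add_mulVec,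
    dotProduct_add, Complex.add_re]

theorem re_star_sum_dotProduct_sum {n : ℕ} (S : Finset ℕ) (x : ℕ → ℝ) (v : ℕ → Fin n → ℂ) :
    (star (∑ i ∈ S, x i • v i) ⬝ᵥ (∑ j ∈ S, x j • v j)).re =
      ∑ i ∈ S, ∑ j ∈ S, x i * (x j * (star (v i) ⬝ᵥ v j).re) := by
  simp only [star_sum, sum_dotProduct, dotProduct_sum, star_smul, smul_dotProduct,
    dotProduct_smul, Complex.re_sum, Complex.smul_re, smul_eq_mul, star_trivial]
  rw [Finset.sum_congr rfl fun i _ => Finset.mul_sum _ _ _, Finset.sum_comm]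
  exact Finset.sum_congr rfl fun i _ => Finset.sum_congr rfl fun j _ => by ring

theorem ExplicitRK.StronglyStable.exists_energy_le {s : ℕ} {rk : ExplicitRK s}
    (hst : rk.StronglyStable) {c : ℕ → ℝ} (hc : rk.HasStabilityCoeffs c) (hc0 : c 0 = 1)
    {N : ℕ} (hN : s < N) {n : ℕ} {L : Matrix (Fin n) (Fin n) ℂ} (hL : LyapunovStable L)
    (hdiss : (-(Lᴴ + L)).PosSemidef) :
    ∃ τ₀ : ℝ, 0 < τ₀ ∧ ∀ τ : ℝ, 0 < τ → τ ≤ τ₀ → ∀ u : Fin n → ℂ,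
      ∑ m ∈ Finset.range (2 * N), τ ^ m * energyCoeff (fun j => c j / j !) (krylovForm L u) m ≤
        energyCoeff (fun j => c j / j !) (krylovForm L u) 0 := by
  obtain ⟨τ₀, hτ₀, h⟩ := hst n L 1 hL Matrix.PosDef.one (by simpa using hdiss)
  refine ⟨τ₀, hτ₀, fun τ h0 h1 u => ?_⟩
  have h2 := h τ h0 h1 u
  rw [weightedNorm, weightedNorm, Matrix.one_mulVec, Matrix.one_mulVec, Real.sqrt_le_sqrt_iff
    (Complex.nonneg_iff.1 (dotProduct_star_self_nonneg u)).1, hc.step_mulVec hN,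
    re_star_sum_dotProduct_sum] at h2
  have h3 := sum_sum_eq_sum_energyCoeff (r := fun j => c j / (j ! : ℝ)) (N := N)
    (fun j hj => by rw [hc.2 j (by omega), zero_div]) (krylovForm L u) τ
  rw [← h3]
  refine h2.trans (le_of_eq ?_)
  simp [energyCoeff, krylovForm, hc0]

/-! ### The conservative scalar problem -/

section Scalar

theorem lyapunovStable_I : LyapunovStable (Complex.I • (1 : Matrix (Fin 1) (Fin 1) ℂ)) := by
  intro μ hμ
  have hlin : Matrix.toLin' (Complex.I • (1 : Matrix (Fin 1) (Fin 1) ℂ)) =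
      Complex.I • (1 : Module.End ℂ (Fin 1 → ℂ)) := by
    rw [map_smul, Matrix.toLin'_one]; rfl
  rw [hlin] at hμ ⊢
  obtain ⟨v, hv⟩ := hμ.exists_hasEigenvector
  have h1 := hv.apply_eq_smul
  have hμI : μ = Complex.I := by
    simp only [LinearMap.smul_apply, Module.End.one_apply] at h1
    exact (smul_left_injective ℂ hv.2 h1).symm
  subst hμI
  refine ⟨by simp, fun _ => ?_⟩
  have htop : Module.End.eigenspace (Complex.I • (1 : Module.End ℂ (Fin 1 → ℂ))) Complex.I = ⊤ := by
    ext v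
    simp
  rw [htop, finrank_top, Module.finrank_fin_fun, Matrix.charpoly, Matrix.det_fin_one]
  simpa using Polynomial.rootMultiplicity_X_sub_C_self (x := Complex.I)

theorem krylovForm_I (i j : ℕ) :
    krylovForm (Complex.I • (1 : Matrix (Fin 1) (Fin 1) ℂ)) 1 i j =
      (star (Complex.I ^ i) * Complex.I ^ j).re := by
  simp [krylovForm, smul_pow, Matrix.smul_mulVec, dotProduct]

theorem krylovForm_I_succ (i j : ℕ) :
    krylovForm (Complex.I • (1 : Matrix (Fin 1) (Fin 1) ℂ)) 1 (i + 1) j +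
      krylovForm (Complex.I • (1 : Matrix (Fin 1) (Fin 1) ℂ)) 1 i (j + 1) = -(0 : ℕ → ℕ → ℝ) i j := by
  rw [krylovForm_succ]
  simp [Matrix.conjTranspose_smul]

theorem krylovForm_I_zero_two_mul (k : ℕ) :
    krylovForm (Complex.I • (1 : Matrix (Fin 1) (Fin 1) ℂ)) 1 0 (2 * k) = (-1) ^ k := by
  rw [krylovForm_I, pow_mul, Complex.I_sq]
  rw [pow_zero, star_one, one_mul, show (-1 : ℂ) = ((-1 : ℝ) : ℂ) by simp, ← Complex.ofReal_pow,
    Complex.ofReal_re]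

theorem krylovForm_I_zero_two_mul_add_one (k : ℕ) :
    krylovForm (Complex.I • (1 : Matrix (Fin 1) (Fin 1) ℂ)) 1 0 (2 * k + 1) = 0 := by
  rw [krylovForm_I, pow_succ, pow_mul, Complex.I_sq]
  rw [pow_zero, star_one, one_mul, show (-1 : ℂ) = ((-1 : ℝ) : ℂ) by simp, ← Complex.ofReal_pow,
    Complex.re_ofReal_mul, Complex.I_re, mul_zero]

theorem energyCoeff_exp_krylovForm_I (m : ℕ) : energyCoeff (fun j => 1 / (j ! : ℝ))
    (krylovForm (Complex.I • (1 : Matrix (Fin 1) (Fin 1) ℂ)) 1) (m + 1) = 0 := by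
  rw [energyCoeff_exp_succ krylovForm_I_succ]
  simp [energyCoeff]

theorem posSemidef_neg_I : (-((Complex.I • (1 : Matrix (Fin 1) (Fin 1) ℂ))ᴴ +
    Complex.I • (1 : Matrix (Fin 1) (Fin 1) ℂ))).PosSemidef := by
  rw [show -((Complex.I • (1 : Matrix (Fin 1) (Fin 1) ℂ))ᴴ + Complex.I • 1) = 0 by
    simp [Matrix.conjTranspose_smul]]
  exact Matrix.PosSemidef.zero

end Scalar

/-! ### The observable problem with rank-one damping -/

section Dissipative

/-- The matrix `i diag(0, …, k) - J / 2`, with `J` the all-ones matrix; its Hermitian part has rank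
one, and it is observable through the sum of the coordinates. -/
noncomputable def rankOneDamped (k : ℕ) : Matrix (Fin (k + 1)) (Fin (k + 1)) ℂ :=
  Matrix.diagonal (fun m => Complex.I * (m.val : ℂ)) - (1 / 2 : ℂ) • Matrix.vecMulVec 1 1

theorem rankOneDamped_mulVec (k : ℕ) (v : Fin (k + 1) → ℂ) :
    rankOneDamped k *ᵥ v = (fun m => Complex.I * (m.val : ℂ) * v m) -
      fun _ => (1 / 2 : ℂ) * ∑ m, v m := by
  ext m
  rw [rankOneDamped, Matrix.sub_mulVec, Matrix.smul_mulVec, Matrix.vecMulVec_mulVec]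
  simp [Matrix.mulVec_diagonal, one_dotProduct]

theorem rankOneDamped_add_conjTranspose (k : ℕ) :
    (rankOneDamped k)ᴴ + rankOneDamped k = -Matrix.vecMulVec 1 1 := by
  ext i j
  by_cases h : i = j
  · subst h
    simp [rankOneDamped]
    ring
  · simp [rankOneDamped, h]
    norm_num

theorem rankOneDamped_dissipative (k : ℕ) :
    (-((rankOneDamped k)ᴴ + rankOneDamped k)).PosSemidef := by
  rw [rankOneDamped_add_conjTranspose, neg_neg]
  simpa using Matrix.posSemidef_vecMulVec_self_star (1 : Fin (k + 1) → ℂ)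

theorem rankOneDamped_krylovForm_succ (k : ℕ) (u : Fin (k + 1) → ℂ) (i j : ℕ) :
    krylovForm (rankOneDamped k) u (i + 1) j + krylovForm (rankOneDamped k) u i (j + 1) =
      -(star (∑ m, (rankOneDamped k ^ i *ᵥ u) m) * ∑ m, (rankOneDamped k ^ j *ᵥ u) m).re := by
  rw [krylovForm_succ, rankOneDamped_add_conjTranspose, Matrix.neg_mulVec, Matrix.vecMulVec_mulVec]
  simp [dotProduct, Finset.sum_mul]

/-- The damping acts only through the coordinate sum, so while that vanishes only the diagonal part
is felt. -/
theorem rankOneDamped_pow_mulVec {k : ℕ} {u : Fin (k + 1) → ℂ} {j : ℕ}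
    (h : ∀ i < j, ∑ m, (rankOneDamped k ^ i *ᵥ u) m = 0) :
    rankOneDamped k ^ j *ᵥ u = fun m => (Complex.I * (m.val : ℂ)) ^ j * u m := by
  induction j with
  | zero => simp
  | succ j ih =>
    have h1 := ih fun i hi => h i (by omega)
    have h2 := h j (by omega)
    rw [pow_succ', ← Matrix.mulVec_mulVec, rankOneDamped_mulVec, h2, h1]
    ext m
    simp
    ring

/-- Vanishing observations form a Vandermonde system with distinct nodes. -/
theorem rankOneDamped_observable {k : ℕ} {u : Fin (k + 1) → ℂ}
    (h : ∀ i ≤ k, ∑ m, (rankOneDamped k ^ i *ᵥ u) m = 0) : u = 0 := by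
  have h1 : u ᵥ* Matrix.vandermonde (fun m : Fin (k + 1) => Complex.I * (m.val : ℂ)) = 0 := by
    ext i
    have h2 := h i (by omega)
    rw [rankOneDamped_pow_mulVec fun j hj => h j (by omega)] at h2
    simp only [Matrix.vecMul, dotProduct, Matrix.vandermonde_apply, Pi.zero_apply]
    rw [← h2]
    exact Finset.sum_congr rfl fun m _ => mul_comm _ _
  refine Matrix.eq_zero_of_vecMul_eq_zero ?_ h1
  rw [Matrix.det_vandermonde_ne_zero_iff]
  intro a b hab
  simpa [Fin.val_inj] using hab

/-- Observability makes the observation map an injective endomorphism of `ℂ ^ (k + 1)`, hence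
surjective. -/
theorem rankOneDamped_exists_dual (k : ℕ) (j : Fin (k + 1)) :
    ∃ w : Fin (k + 1) → ℂ, ∀ i : Fin (k + 1),
      ∑ m, (rankOneDamped k ^ i.val *ᵥ w) m = if i = j then 1 else 0 := by
  let Φ : (Fin (k + 1) → ℂ) →ₗ[ℂ] (Fin (k + 1) → ℂ) :=
    LinearMap.pi fun i => (∑ m, LinearMap.proj m) ∘ₗ Matrix.toLin' (rankOneDamped k ^ i.val)
  have hΦ : ∀ u i, Φ u i = ∑ m, (rankOneDamped k ^ i.val *ᵥ u) m := by
    intro u i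
    simp only [Φ, LinearMap.pi_apply, LinearMap.comp_apply, LinearMap.sum_apply,
      LinearMap.proj_apply, Matrix.toLin'_apply]
  have hinj : Function.Injective Φ := by
    rw [← LinearMap.ker_eq_bot, LinearMap.ker_eq_bot']
    intro u hu
    refine rankOneDamped_observable fun i hi => ?_
    have := congrFun hu ⟨i, by omega⟩
    rwa [hΦ] at this
  obtain ⟨w, hw⟩ := LinearMap.injective_iff_surjective.1 hinj (fun i => if i = j then 1 else 0)
  exact ⟨w, fun i => by rw [← hΦ, hw]⟩

/-- An eigenvector `v` has nonzero coordinate sum by observability, and `2 Re μ ‖v‖² = -|∑ v|²`; the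
multiplicity condition is thus vacuous. -/
theorem rankOneDamped_lyapunovStable (k : ℕ) : LyapunovStable (rankOneDamped k) := by
  intro μ hμ
  suffices h : μ.re < 0 from ⟨h.le, fun h0 => absurd h0 h.ne⟩
  obtain ⟨v, hv⟩ := hμ.exists_hasEigenvector
  have h1 : rankOneDamped k *ᵥ v = μ • v := by simpa using hv.apply_eq_smul
  have hv0 : v ≠ 0 := hv.2
  have hpow : ∀ i : ℕ, rankOneDamped k ^ i *ᵥ v = μ ^ i • v := by
    intro i
    induction i with
    | zero => simp
    | succ i ih => rw [pow_succ', ← Matrix.mulVec_mulVec, ih, Matrix.mulVec_smul, h1, smul_smul,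
        pow_succ]
  have hsum : ∑ m, v m ≠ 0 := by
    intro h0
    refine hv0 (rankOneDamped_observable fun i _ => ?_)
    rw [hpow]
    simp [← Finset.mul_sum, h0]
  have h2 := rankOneDamped_krylovForm_succ k v 0 0
  rw [krylovForm_comm _ _ (0 + 1) 0] at h2
  have hpos : 0 < (star v ⬝ᵥ v).re :=
    (Complex.pos_iff.1 (Matrix.dotProduct_star_self_pos_iff.2 hv0)).1
  have him : (star v ⬝ᵥ v).im = 0 :=
    (Complex.nonneg_iff.1 (dotProduct_star_self_nonneg v)).2.symm
  have h3 : krylovForm (rankOneDamped k) v 0 (0 + 1) = μ.re * (star v ⬝ᵥ v).re := by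
    rw [krylovForm, hpow, hpow, pow_zero, one_smul, zero_add, pow_one, dotProduct_smul, smul_eq_mul,
      Complex.mul_re, him]
    ring
  have h4 : (star (∑ m, (rankOneDamped k ^ 0 *ᵥ v) m) * ∑ m, (rankOneDamped k ^ 0 *ᵥ v) m).re =
      Complex.normSq (∑ m, v m) := by
    rw [pow_zero, Matrix.one_mulVec, Complex.star_def, ← Complex.normSq_eq_conj_mul_self,
      Complex.ofReal_re]
  rw [h3, h4] at h2
  have h5 := Complex.normSq_pos.2 hsum
  by_contra! h6
  have := mul_nonneg h6 hpos.le
  linarith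

end Dissipative

/-! ### The three instability criteria -/

theorem not_stronglyStable_of_odd {s : ℕ} {rk : ExplicitRK s} {k : ℕ} {c : ℕ → ℝ}
    (hc : rk.HasStabilityCoeffs c) (hone : ∀ j ≤ 2 * k + 1, c j = 1)
    (h : (-1 : ℝ) ^ (k + 1) * (1 - c (2 * k + 2)) < 0) : ¬ rk.StronglyStable := by
  intro hst
  obtain ⟨τ₀, hτ₀, hle⟩ := hst.exists_energy_le hc (hone 0 (by omega))
    (N := s + 2 * k + 3) (by omega) lyapunovStable_I posSemidef_neg_I
  have hr : ∀ j ≤ 2 * k + 1, c j / (j ! : ℝ) = 1 / (j ! : ℝ) := fun j hj => by rw [hone j hj]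
  refine not_le_of_first_coeff_pos (M := 2 * (s + 2 * k + 3) - 1) (m₀ := 2 * k + 1) (by omega) ?_ ?_
    hτ₀ fun τ h0 h1 => hle τ h0 h1 1
  · intro m hm
    rw [energyCoeff_congr hr _ (by omega), energyCoeff_exp_krylovForm_I]
  · rw [energyCoeff_first_defect (by omega) hr (by simp) (krylovForm_comm _ _),
      energyCoeff_exp_krylovForm_I, zero_add, show 2 * k + 1 + 1 = 2 * (k + 1) by ring,
      krylovForm_I_zero_two_mul, ← sub_div]
    rw [show 2 * k + 2 = 2 * (k + 1) by ring] at h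
    have : 0 < (((2 * (k + 1))! : ℕ) : ℝ) := by positivity
    rw [show 2 * ((c (2 * (k + 1)) - 1) / ((2 * (k + 1))! : ℝ)) * (-1) ^ (k + 1) =
      2 * -((-1) ^ (k + 1) * (1 - c (2 * (k + 1)))) / ((2 * (k + 1))! : ℝ) by ring]
    exact div_pos (by linarith) this

theorem not_stronglyStable_of_even_of_normal {s : ℕ} {rk : ExplicitRK s} {k : ℕ} (hk : 1 ≤ k)
    {c : ℕ → ℝ} (hc : rk.HasStabilityCoeffs c) (hone : ∀ j ≤ 2 * k, c j = 1)
    (h : (-1 : ℝ) ^ k * (c (2 * k + 2) - (2 * k + 2) * c (2 * k + 1) + (2 * k + 1)) < 0) :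
    ¬ rk.StronglyStable := by
  intro hst
  obtain ⟨τ₀, hτ₀, hle⟩ := hst.exists_energy_le hc (hone 0 (by omega))
    (N := s + 2 * k + 3) (by omega) lyapunovStable_I posSemidef_neg_I
  have hr : ∀ j ≤ 2 * k, c j / (j ! : ℝ) = 1 / (j ! : ℝ) := fun j hj => by rw [hone j hj]
  refine not_le_of_first_coeff_pos (M := 2 * (s + 2 * k + 3) - 1) (m₀ := 2 * k + 1) (by omega) ?_ ?_
    hτ₀ fun τ h0 h1 => hle τ h0 h1 1
  · intro m hm
    rcases Nat.lt_or_ge m (2 * k) with hlt | hge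
    · rw [energyCoeff_congr hr _ (by omega), energyCoeff_exp_krylovForm_I]
    · rw [show m = 2 * k by omega, energyCoeff_first_defect (by omega) hr (by simp)
        (krylovForm_comm _ _), energyCoeff_exp_krylovForm_I, krylovForm_I_zero_two_mul_add_one]
      simp
  · have hb := krylovForm_I_succ 0 (2 * k + 1)
    rw [show 2 * k + 1 + 1 = 2 * (k + 1) by ring, krylovForm_I_zero_two_mul] at hb
    simp only [Pi.zero_apply, neg_zero, zero_add] at hb
    rw [energyCoeff_second_defect (by omega) hr (by simp) (by simp) (krylovForm_comm _ _),
      energyCoeff_exp_krylovForm_I, zero_add, show 2 * k + 2 = 2 * (k + 1) by ring,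
      krylovForm_I_zero_two_mul, eq_neg_of_add_eq_zero_left hb, ← sub_div, ← sub_div]
    rw [show 2 * (k + 1) = 2 * k + 1 + 1 by ring, Nat.factorial_succ (2 * k + 1)]
    have hf : 0 < ((2 * k + 1)! : ℝ) := by positivity
    push_cast
    have : 0 < (2 * (k : ℝ) + 1 + 1) * ((2 * k + 1)! : ℝ) := by positivity
    refine lt_of_lt_of_eq (div_pos (a := 2 * -((-1 : ℝ) ^ k * (c (2 * k + 2) -
      (2 * k + 2) * c (2 * k + 1) + (2 * k + 1)))) (by linarith) this) ?_
    field_simp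
    ring

theorem not_stronglyStable_of_even_of_damped {s : ℕ} {rk : ExplicitRK s} {k : ℕ} (hk : 1 ≤ k)
    {c : ℕ → ℝ} (hc : rk.HasStabilityCoeffs c) (hone : ∀ j ≤ 2 * k, c j = 1)
    (h : 1 + (-1 : ℝ) ^ k * (c (2 * k + 1) - 1) * ((2 * k).choose k : ℝ) < 0) :
    ¬ rk.StronglyStable := by
  intro hst
  obtain ⟨τ₀, hτ₀, hle⟩ := hst.exists_energy_le hc (hone 0 (by omega))
    (N := s + 2 * k + 3) (by omega) (rankOneDamped_lyapunovStable k) (rankOneDamped_dissipative k)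
  choose w hw using rankOneDamped_exists_dual k
  -- The dual vectors prescribe the observations as the derivatives at `0` of `τ ^ k` times the
  -- Legendre polynomial in `t / τ`.
  let u : ℝ → Fin (k + 1) → ℂ := fun τ =>
    ∑ j : Fin (k + 1), ((τ ^ (k - j.val) * legendreCoeff k j : ℝ) : ℂ) • w j
  have hu : Continuous u := by fun_prop
  have hAu : ∀ i, Continuous fun τ => rankOneDamped k ^ i *ᵥ u τ := fun i => by fun_prop
  refine not_le_of_legendre (k := k) (N := s + 2 * k + 3) hk (by omega)
    (r := fun j => c j / j !) (fun j hj => by simp only [hone j hj])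
    (b := fun τ => krylovForm (rankOneDamped k) (u τ))
    (y := fun τ i => ∑ m, (rankOneDamped k ^ i *ᵥ u τ) m) ?_ ?_
    (fun τ => rankOneDamped_krylovForm_succ k (u τ)) (fun τ => krylovForm_comm _ _) ?_ ?_ hτ₀
    fun τ h0 h1 => hle τ h0 h1 (u τ)
  · intro i j
    have h1 := hAu i
    have h2 := hAu j
    unfold krylovForm dotProduct
    fun_prop
  · intro i
    have h1 := hAu i
    fun_prop
  · intro τ i hi
    have h1 := fun j => hw j ⟨i, by omega⟩
    simp only at h1
    simp only [u, Matrix.mulVec_sum, Matrix.mulVec_smul, Finset.sum_apply, Pi.smul_apply]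
    rw [Finset.sum_comm]
    simp only [smul_eq_mul, ← Finset.mul_sum, h1, mul_ite, mul_zero, mul_one]
    rw [Finset.sum_ite_eq, if_pos (Finset.mem_univ _)]
  · have hch : ((2 * k).choose k : ℝ) * k ! * k ! = (2 * k)! := by
      have := Nat.choose_mul_factorial_mul_factorial (show k ≤ 2 * k by omega)
      rw [show 2 * k - k = k by omega] at this
      exact_mod_cast this
    have hk0 : (k ! : ℝ) ≠ 0 := by positivity
    have hk1 : (0 : ℝ) < (k ! : ℝ) ^ 2 / (2 * k + 1) := by positivity
    -- Since `(2k)!` is the binomial coefficient times `(k!)²`, the leading coefficient is `-(k!)² /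
    -- (2k + 1)` times the left side of `h`.
    refine lt_of_lt_of_eq (mul_pos hk1 (neg_pos.2 h)) ?_
    rw [Nat.factorial_succ, ← hch]
    have hf : ((2 * k).choose k : ℝ) ≠ 0 := by
      exact_mod_cast (Nat.choose_pos (show k ≤ 2 * k by omega)).ne'
    push_cast
    rw [← hch]
    field_simp
    ring

theorem mainTheorem4 {s : ℕ} (rk : ExplicitRK s) (p : ℕ) (hp : 1 ≤ p) (hord : rk.HasOrder p)
    (c : ℕ → ℝ) (hc : rk.HasStabilityCoeffs c) :
    (Odd p → (-1 : ℝ) ^ ((p + 1) / 2) * (1 - c (p + 1)) < 0 → ¬ rk.StronglyStable) ∧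
    (Even p →
      ((-1 : ℝ) ^ (p / 2) * (c (p + 2) - ((p : ℝ) + 2) * c (p + 1) + ((p : ℝ) + 1)) < 0 ∨
        1 + (-1 : ℝ) ^ (p / 2) * (c (p + 1) - 1) * (p.choose (p / 2) : ℝ) < 0) →
      ¬ rk.StronglyStable) := by
  have hone : ∀ j ≤ p, c j = 1 := fun j hj => hord.coeff_eq_one hc hj
  constructor
  · rintro ⟨k, rfl⟩ h
    rw [show (2 * k + 1 + 1) / 2 = k + 1 by omega] at h
    exact not_stronglyStable_of_odd hc hone h
  · intro he h
    obtain ⟨k, rfl⟩ := he.two_dvd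
    rw [show 2 * k / 2 = k by omega] at h
    push_cast at h
    rcases h with h | h
    · exact not_stronglyStable_of_even_of_normal (by omega) hc hone h
    · exact not_stronglyStable_of_even_of_damped (by omega) hc hone h
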